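/- A tri-colored sum-free set of size $m$ in an abelian group $H$ is a collection $\{(a_i,b_i,c_i)\}_{i=1}^m$ of ordered triples in $H^3$ such that, for all $i,j,k\in\{1,\dots,m\}$, the equation $a_i+b_j+c_k=0$ holds if and only if $i=j=k$. For all sufficiently large $n$ there exists a tri-colored sum-free set $\{(a_i,b_i,c_i)\}_{i=1}^m$ in $\mathbb{F}_2^n$ of size $$m>\binom{n}{\lfloor n/3\rfloor}\cdot 2^{-\sqrt{16n/3}},$$ such that moreover, for every $i$, the vectors $a_i,b_i,c_i$ have Hamming weights $\lfloor n/3\rfloor$, $\lfloor n/3\rfloor$, $2\lfloor n/3\rfloor$ respectively, and $c_i=a_i+b_i$. Consequently the quantity $6\binom{n}{\lfloor n/3\rfloor}$ (an upper bound for the size of any tri-colored sum-free set in $\mathbb{F}_2^n$, which is not part of this assertion) is attained up to a factor subexponential in $n$: there is a function $f:\mathbb{N}\to[1,\infty)$ with $\log f(n)=o(n)$ such that for all sufficiently large $n$ there is a tri-colored sum-free set in $\mathbb{F}_2^n$ of size $m$ with $6\binom{n}{\lfloor n/3\rfloor}\le f(n)\,m$. -/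

import Mathlib

/-- A tri-colored sum-free set of size `m` in an abelian group `H`: a collection of ordered triples
`(a i, b i, c i)`, `i = 1, …, m`, such that `a i + b j + c k = 0` holds if and only if
`i = j = k`. -/
def IsTriColoredSumFree {H : Type*} [AddCommGroup H] {m : ℕ} (a b c : Fin m → H) : Prop :=
  ∀ i j k : Fin m, a i + b j + c k = 0 ↔ i = j ∧ j = k

/-- A factor `f : ℕ → ℝ`, with `f n ≥ 1` for all `n`, that is subexponential in `n`:
`f n = exp (o(n))`. -/
def IsSubexponentialFactor (f : ℕ → ℝ) : Prop :=
  (∀ n, 1 ≤ f n) ∧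
    Asymptotics.IsLittleO Filter.atTop (fun n : ℕ => Real.log (f n)) (fun n : ℕ => (n : ℝ))

open Finset

/-! Put k = n/3 and D = C(n-k, k). The triples are indicator vectors of A, B and A ∪ B for disjoint
k-sets A, B, selected by a random linear hash into `ZMod P`, with P a prime between 100D and 200D. A
pair is kept when its two hash values agree and lie in a set S without 3-term progressions, and kept
pairs that conflict with another kept pair are discarded. If A_i, B_j and A_l ∪ B_l give a zero sum,
cardinality makes A_i, B_j disjoint with union A_l ∪ B_l. Their hash values then form a progression
in S, so they coincide, (A_i, B_j) is itself kept, and isolation forces i = j = l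
(`exists_triColoredSumFree_of_threeAPFree`). A first-moment count leaves about C(n,k)·|S|/P pairs,
up to a constant. Since P is at most about 2^(2n/3), Behrend's density 2^(-2√(2 log₂ P)) already
matches 2^(-√(16n/3)), with no room for constants. Elkin's extra factor √d, d ≈ √(4n/3), supplies
that room. It is obtained by averaging over affine lines through a thick spherical shell
(`exists_threeAPFree_of_difference_subset`). -/

/-! ### Second moments and a popular shell. -/

theorem sum_pi_sum_eq_zero {ι : Type*} [Fintype ι] {g : ι → ℝ} (hg : ∑ a, g a = 0) (d : ℕ) :
    ∑ x : Fin d → ι, ∑ i, g (x i) = 0 := by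
  classical
  induction d with
  | zero => simp
  | succ d ih =>
    rw [← (Fin.consEquiv (fun _ : Fin (d + 1) => ι)).sum_comp, Fintype.sum_prod_type]
    simp [Fin.consEquiv, Fin.sum_univ_succ, sum_add_distrib, ih, ← Finset.mul_sum, hg]

/-- Additivity of variance: cross terms vanish because `g` has mean zero. The extra factor on the
left avoids an exponent d - 1. -/
theorem card_mul_sum_pi_sum_sq {ι : Type*} [Fintype ι] {g : ι → ℝ} (hg : ∑ a, g a = 0) (d : ℕ) :
    (Fintype.card ι : ℝ) * ∑ x : Fin d → ι, (∑ i, g (x i)) ^ 2 =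
      d * (Fintype.card ι : ℝ) ^ d * ∑ a, g a ^ 2 := by
  classical
  induction d with
  | zero => simp
  | succ d ih =>
    rw [← (Fin.consEquiv (fun _ : Fin (d + 1) => ι)).sum_comp, Fintype.sum_prod_type]
    have h0 := sum_pi_sum_eq_zero hg d
    simp only [Fin.consEquiv, Equiv.coe_fn_mk, Fin.sum_univ_succ, Fin.cons_zero, Fin.cons_succ,
      add_sq, sum_add_distrib, mul_assoc, ← Finset.mul_sum, h0, mul_zero, sum_const, card_univ,
      Fintype.card_pi, prod_const, Fintype.card_fin, nsmul_eq_mul, add_zero, mul_add]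
    rw [ih]
    push_cast
    ring

/-- Chebyshev's inequality at two standard deviations, with K bounding the deviation of one
coordinate; μ is the mean of the sum. -/
theorem card_filter_sq_le {ι : Type*} [Fintype ι] [Nonempty ι] {f : ι → ℝ} {K : ℝ} (hK : 0 < K)
    (hf : ∀ a, 0 ≤ f a ∧ f a ≤ K) {d : ℕ} (hd : 0 < d) :
    ∃ μ : ℝ, 4 * (#{x : Fin d → ι | 2 * √d * K ≤ |(∑ i, f (x i)) - μ|} : ℝ) ≤
      (Fintype.card ι : ℝ) ^ d := by
  classical
  set N : ℝ := ((Fintype.card ι : ℕ) : ℝ) with hN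
  have hNpos : 0 < N := by rw [hN]; exact_mod_cast Fintype.card_pos
  set ν : ℝ := (∑ a, f a) / N with hν
  have hsum : ∑ a, (f a - ν) = 0 := by
    rw [sum_sub_distrib]; simp [hν, ← hN]; field_simp; simp
  have hν0 : 0 ≤ ν := div_nonneg (sum_nonneg fun a _ => (hf a).1) hNpos.le
  have hνK : ν ≤ K := by
    rw [hν, div_le_iff₀ hNpos]
    calc ∑ a, f a ≤ ∑ _a : ι, K := sum_le_sum fun a _ => (hf a).2
      _ = K * N := by simp [hN, mul_comm]
  have hsq : ∑ a, (f a - ν) ^ 2 ≤ N * K ^ 2 := by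
    calc ∑ a, (f a - ν) ^ 2 ≤ ∑ _a : ι, K ^ 2 := by
          refine sum_le_sum fun a _ => ?_
          have := hf a
          exact sq_le_sq' (by linarith) (by linarith)
      _ = N * K ^ 2 := by simp [hN]
  have hvar := card_mul_sum_pi_sum_sq hsum d
  rw [← hN] at hvar
  refine ⟨d * ν, ?_⟩
  set T := ({x : Fin d → ι | 2 * √d * K ≤ |(∑ i, f (x i)) - d * ν|} : Finset _)
  have hT : (#T : ℝ) * (4 * d * K ^ 2) ≤ ∑ x : Fin d → ι, (∑ i, (f (x i) - ν)) ^ 2 := by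
    calc (#T : ℝ) * (4 * d * K ^ 2) = ∑ x ∈ T, (4 * d * K ^ 2) := by simp
      _ ≤ ∑ x ∈ T, (∑ i, (f (x i) - ν)) ^ 2 := by
          refine sum_le_sum fun x hx => ?_
          have hx' : 2 * √d * K ≤ |(∑ i, f (x i)) - d * ν| := by simpa [T] using hx
          have : (2 * √d * K) ^ 2 ≤ |(∑ i, f (x i)) - d * ν| ^ 2 :=
            pow_le_pow_left₀ (by positivity) hx' 2
          rw [sq_abs, mul_pow, mul_pow, Real.sq_sqrt (Nat.cast_nonneg d)] at this
          simp only [sum_sub_distrib, sum_const, card_univ, Fintype.card_fin, nsmul_eq_mul]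
          linarith
      _ ≤ _ := sum_le_sum_of_subset_of_nonneg (subset_univ _) fun _ _ _ => sq_nonneg _
  have hdpos : (0 : ℝ) < d := by exact_mod_cast hd
  have h1 : N * ((#T : ℝ) * (4 * d * K ^ 2)) ≤ d * N ^ d * (N * K ^ 2) := by
    calc _ ≤ N * _ := mul_le_mul_of_nonneg_left hT hNpos.le
      _ = _ := hvar
      _ ≤ _ := mul_le_mul_of_nonneg_left hsq (by positivity)
  have h2 : (N * d * K ^ 2) * (4 * #T) ≤ (N * d * K ^ 2) * N ^ d := by linarith
  exact le_of_mul_le_mul_left h2 (by positivity)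

/-- By concentration, three quarters of the points lie in O(1 + √d K / R) shells of width R;
pigeonhole picks one. Using √d K rather than the trivial range d K is the source of the gain √d. -/
theorem exists_large_shell {ι : Type*} [Fintype ι] [Nonempty ι] {f : ι → ℝ} {K R : ℝ} (hK : 0 < K)
    (hR : 0 < R) (hf : ∀ a, 0 ≤ f a ∧ f a ≤ K) {d : ℕ} (hd : 0 < d) :
    ∃ j : ℤ, (Fintype.card ι : ℝ) ^ d * min 1 (R / (√d * K)) ≤
      8 * #{x : Fin d → ι | ⌊(∑ i, f (x i)) / R⌋ = j} := by
  classical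
  obtain ⟨μ, hμ⟩ := card_filter_sq_le hK hf hd
  have hdpos : (0 : ℝ) < √d := Real.sqrt_pos.2 (by exact_mod_cast hd)
  set N : ℝ := ((Fintype.card ι : ℕ) : ℝ) with hN
  set r := 2 * √d * K with hr
  have hrpos : 0 < r := by positivity
  set T := ({x : Fin d → ι | r ≤ |(∑ i, f (x i)) - μ|} : Finset _) with hTdef
  have hTc : (#Tᶜ : ℝ) = N ^ d - #T := by
    rw [card_compl]
    rw [Nat.cast_sub (card_le_univ _)]
    simp [hN]
  set J := Icc ⌊(μ - r) / R⌋ ⌊(μ + r) / R⌋ with hJ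
  have hmaps : ∀ x ∈ Tᶜ, ⌊(∑ i, f (x i)) / R⌋ ∈ J := by
    intro x hx
    have hx' : |(∑ i, f (x i)) - μ| < r := by simpa [hTdef] using hx
    rw [abs_lt] at hx'
    rw [hJ, mem_Icc]
    constructor <;> refine Int.floor_le_floor (div_le_div_of_nonneg_right ?_ hR.le) <;> linarith
  set t := min 1 (R / (√d * K)) with ht
  have htpos : 0 < t := lt_min one_pos (by positivity)
  have hJcard : (#J : ℝ) * t ≤ 6 := by
    have hle : ⌊(μ - r) / R⌋ ≤ ⌊(μ + r) / R⌋ :=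
      Int.floor_le_floor (div_le_div_of_nonneg_right (by linarith) hR.le)
    have h1 : (#J : ℝ) = ⌊(μ + r) / R⌋ + 1 - ⌊(μ - r) / R⌋ := by
      rw [hJ, Int.card_Icc]
      have : (((⌊(μ + r) / R⌋ + 1 - ⌊(μ - r) / R⌋).toNat : ℤ) : ℝ) =
        ((⌊(μ + r) / R⌋ + 1 - ⌊(μ - r) / R⌋ : ℤ) : ℝ) := by
        rw [Int.toNat_of_nonneg (by omega)]
      push_cast at this
      exact_mod_cast this
    have h2 : (#J : ℝ) ≤ 4 * (√d * K / R) + 2 := by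
      have a1 := Int.floor_le ((μ + r) / R)
      have a2 := Int.lt_floor_add_one ((μ - r) / R)
      have a3 : (μ + r) / R - (μ - r) / R = 4 * (√d * K / R) := by rw [hr]; ring
      linarith
    have h3 : √d * K / R * t ≤ 1 := by
      calc √d * K / R * t ≤ √d * K / R * (R / (√d * K)) :=
            mul_le_mul_of_nonneg_left (min_le_right _ _) (by positivity)
        _ = 1 := by field_simp
    have h4 : t ≤ 1 := min_le_left _ _
    nlinarith
  have hJne : J.Nonempty := by
    rw [hJ, nonempty_Icc]
    exact Int.floor_le_floor (div_le_div_of_nonneg_right (by linarith) hR.le)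
  obtain ⟨j, -, hj⟩ := exists_max_image J
    (fun j => #{x : Fin d → ι | ⌊(∑ i, f (x i)) / R⌋ = j}) hJne
  refine ⟨j, ?_⟩
  set c := #{x : Fin d → ι | ⌊(∑ i, f (x i)) / R⌋ = j}
  have hcard : #Tᶜ ≤ #J * c := by
    rw [card_eq_sum_card_fiberwise hmaps, ← smul_eq_mul]
    refine sum_le_card_nsmul _ _ _ fun i hi => le_trans (card_le_card ?_) (hj i hi)
    exact filter_subset_filter _ (subset_univ _)
  have hcard' : (#Tᶜ : ℝ) ≤ #J * c := by exact_mod_cast hcard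
  have h5 : 3 / 4 * N ^ d ≤ #J * c := by linarith
  have h6 : 3 / 4 * N ^ d * t ≤ 6 * c := by
    calc 3 / 4 * N ^ d * t ≤ #J * c * t := mul_le_mul_of_nonneg_right h5 htpos.le
      _ = #J * t * c := by ring
      _ ≤ 6 * c := mul_le_mul_of_nonneg_right hJcard (Nat.cast_nonneg _)
  linarith

/-! ### Lattice points in a ball. -/

theorem sum_Icc_exp_neg_abs_le {ρ : ℝ} (hρ : 0 < ρ) (K : ℕ) :
    ∑ j ∈ Icc (-(K : ℤ)) K, Real.exp (-(|(j : ℝ)| / ρ)) ≤ 1 + 2 * ρ := by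
  set q := Real.exp (-(1 / ρ)) with hq
  have hq1 : q < 1 := by rw [hq, Real.exp_lt_one_iff]; simpa using hρ
  have hq0 : 0 < q := Real.exp_pos _
  have hpow : ∀ k : ℕ, Real.exp (-((k : ℝ) / ρ)) = q ^ k := by
    intro k; rw [hq, ← Real.exp_nat_mul]; congr 1; ring
  have key : ∀ K : ℕ, ∑ j ∈ Icc (-(K : ℤ)) K, Real.exp (-(|(j : ℝ)| / ρ)) =
      1 + 2 * ∑ k ∈ range K, q ^ (k + 1) := by
    intro K
    induction K with
    | zero => simp
    | succ K ih =>
      have : Icc (-((K + 1 : ℕ) : ℤ)) ((K + 1 : ℕ) : ℤ) =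
          insert (-((K + 1 : ℕ) : ℤ)) (insert ((K + 1 : ℕ) : ℤ) (Icc (-(K : ℤ)) K)) := by
        ext j; simp only [mem_Icc, mem_insert]; push_cast; omega
      rw [this, sum_insert, sum_insert, ih, sum_range_succ]
      · have e1 : |(((-((K + 1 : ℕ) : ℤ)) : ℤ) : ℝ)| = ((K + 1 : ℕ) : ℝ) := by
          rw [Int.cast_neg, abs_neg, Int.cast_natCast, Nat.abs_cast]
        have e2 : |((((K + 1 : ℕ) : ℤ)) : ℝ)| = ((K + 1 : ℕ) : ℝ) := by
          rw [Int.cast_natCast, Nat.abs_cast]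
        rw [e1, e2, hpow]; ring
      · simp
      · simp only [mem_insert, mem_Icc, not_or]; push_cast; omega
  rw [key]
  have hgeom : ∑ k ∈ range K, q ^ (k + 1) ≤ q / (1 - q) := by
    simp_rw [pow_succ, ← sum_mul]
    rw [div_eq_inv_mul]
    refine mul_le_mul_of_nonneg_right ?_ hq0.le
    rw [← tsum_geometric_of_lt_one hq0.le hq1]
    exact (summable_geometric_of_lt_one hq0.le hq1).sum_le_tsum _ fun _ _ => by positivity
  -- The left side is 1/(e^(1/ρ) - 1), and e^(1/ρ) ≥ 1 + 1/ρ.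
  have hle : q / (1 - q) ≤ ρ := by
    rw [div_le_iff₀ (by linarith)]
    have h1 : 1 / ρ + 1 ≤ Real.exp (1 / ρ) := Real.add_one_le_exp _
    have h2 : q * Real.exp (1 / ρ) = 1 := by rw [hq, ← Real.exp_add]; simp
    have h3 : q * (1 / ρ + 1) ≤ 1 := by
      exact (mul_le_mul_of_nonneg_left h1 hq0.le).trans_eq h2
    have h4 : ρ * (q * (1 / ρ + 1)) = q + ρ * q := by field_simp
    nlinarith
  linarith

/-- The points of the cube `[-K, K] ^ d` in `ℤ ^ d` of squared Euclidean norm less than `R`. -/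
noncomputable def intBall (d K : ℕ) (R : ℝ) : Finset (Fin d → ℤ) :=
  (Fintype.piFinset fun _ => Icc (-(K : ℤ)) K).filter fun x => ∑ i, (x i : ℝ) ^ 2 < R

/-- An exponential-weight bound: on the ball, AM-GM gives ∑|x_i| ≤ dρ, so the product weight
e^(1-|x_i|/ρ) is at least 1 there. Its sum over the whole cube factors into one-dimensional
geometric sums. -/
theorem card_intBall_le (d K : ℕ) {ρ : ℝ} (hρ : 1 ≤ ρ) :
    (#(intBall d K (d * ρ ^ 2)) : ℝ) ≤ (9 * ρ) ^ d := by
  have hρ0 : 0 < ρ := by linarith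
  set B := intBall d K (d * ρ ^ 2) with hB
  have hone : ∀ x ∈ B, (1 : ℝ) ≤ ∏ i, Real.exp 1 * Real.exp (-(|(x i : ℝ)| / ρ)) := by
    intro x hx
    have hx' := (mem_filter.1 hx).2
    simp_rw [← Real.exp_add]
    rw [← Real.exp_sum, Real.one_le_exp_iff]
    have h1 : ∀ i, 2 * ρ * |(x i : ℝ)| ≤ (x i : ℝ) ^ 2 + ρ ^ 2 := by
      intro i
      rw [← sq_abs (x i : ℝ)]
      nlinarith [sq_nonneg (|(x i : ℝ)| - ρ)]
    have h2 : 2 * ρ * ∑ i, |(x i : ℝ)| ≤ 2 * (d * ρ ^ 2) := by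
      rw [mul_sum]
      calc _ ≤ ∑ i, ((x i : ℝ) ^ 2 + ρ ^ 2) := sum_le_sum fun i _ => h1 i
        _ ≤ _ := by rw [sum_add_distrib]; simp; linarith
    have h3 : (∑ i, |(x i : ℝ)|) / ρ ≤ d := by
      rw [div_le_iff₀ hρ0]
      have : 2 * ρ * ∑ i, |(x i : ℝ)| ≤ 2 * ρ * (d * ρ) := by linarith
      exact le_of_mul_le_mul_left this (by positivity)
    rw [sum_add_distrib, sum_neg_distrib, ← sum_div]
    simp only [sum_const, card_univ, Fintype.card_fin, nsmul_eq_mul, mul_one]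
    linarith
  calc (#B : ℝ) = ∑ x ∈ B, (1 : ℝ) := by simp
    _ ≤ ∑ x ∈ B, ∏ i, Real.exp 1 * Real.exp (-(|(x i : ℝ)| / ρ)) := sum_le_sum hone
    _ ≤ ∑ x ∈ (Fintype.piFinset fun _ => Icc (-(K : ℤ)) K : Finset (Fin d → ℤ)),
          ∏ i, Real.exp 1 * Real.exp (-(|(x i : ℝ)| / ρ)) :=
        sum_le_sum_of_subset_of_nonneg (filter_subset _ _) fun _ _ _ => by positivity
    _ = (∑ j ∈ Icc (-(K : ℤ)) K, Real.exp 1 * Real.exp (-(|(j : ℝ)| / ρ))) ^ d := by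
        rw [sum_pow']
    _ ≤ (9 * ρ) ^ d := by
        refine pow_le_pow_left₀ (sum_nonneg fun _ _ => by positivity) ?_ d
        rw [← mul_sum]
        have h1 := sum_Icc_exp_neg_abs_le hρ0 K
        have h2 : Real.exp 1 ≤ 3 := Real.exp_one_lt_three.le
        calc _ ≤ 3 * (1 + 2 * ρ) := mul_le_mul h2 h1 (sum_nonneg fun _ _ => by positivity) (by simp)
          _ ≤ 9 * ρ := by linarith

/-! ### Progression-free sets of Behrend-Elkin type. -/

/-- Pull S back along a random affine map t ↦ t·p₁ + p₂ and delete the middle terms of nontrivial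
progressions. A deleted t has s·p₁ ∈ B for some s ≠ 0; since B is small, this removes on average at
most half of the pullback. -/
theorem exists_threeAPFree_of_difference_subset {F V : Type*} [Field F] [Fintype F] [DecidableEq F]
    [AddCommGroup V] [Module F V] [Fintype V] [DecidableEq V] (S B : Finset V)
    (hSB : ∀ x ∈ S, ∀ y ∈ S, ∀ z ∈ S, x + y = z + z → y - z ∈ B)
    (hB : 2 * (Fintype.card F * #B) ≤ Fintype.card V) :
    ∃ A : Finset F, ThreeAPFree (A : Set F) ∧
      Fintype.card F * #S ≤ 2 * Fintype.card V * #A := by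
  let A : V × V → Finset F := fun p => {t | t • p.1 + p.2 ∈ S ∧
    ∀ s : F, s ≠ 0 → ¬ ((t - s) • p.1 + p.2 ∈ S ∧ (t + s) • p.1 + p.2 ∈ S)}
  have hfree : ∀ p, ThreeAPFree (A p : Set F) := by
    intro p a ha b hb c hc h
    by_contra hne
    simp only [A, coe_filter, mem_univ, true_and, Set.mem_ofPred_eq] at ha hb hc
    refine hb.2 (b - a) (sub_ne_zero.2 (Ne.symm hne)) ⟨?_, ?_⟩
    · rw [sub_sub_cancel]; exact ha.1
    · rw [show b + (b - a) = c by rw [← add_sub_assoc, ← h]; ring]; exact hc.1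
  have hpt : ∀ t : F, Fintype.card V * #S ≤ 2 * #{p : V × V | t ∈ A p} := by
    intro t
    set G : Finset (V × V) := {p | t • p.1 + p.2 ∈ S} with hG
    set E : F → Finset (V × V) := fun s =>
      {p | t • p.1 + p.2 ∈ S ∧ s ≠ 0 ∧ s • p.1 ∈ B} with hE
    have hGcard : Fintype.card V * #S ≤ #G := by
      rw [← card_univ, ← card_product]
      refine card_le_card_of_injOn (fun q => (q.1, q.2 - t • q.1)) ?_ ?_
      · intro q hq
        simp only [coe_product, coe_univ, Set.mem_prod, Set.mem_univ, mem_coe, true_and] at hq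
        simpa [hG] using hq
      · intro q _ q' _ h
        simp only [Prod.mk.injEq] at h
        obtain ⟨h1, h2⟩ := h
        rw [h1] at h2
        exact Prod.ext h1 (sub_left_injective h2)
    -- For s ≠ 0 the point s·p₁ determines p₁, and then t·p₁ + p₂ determines p₂.
    have hEcard : ∀ s, #(E s) ≤ #B * #S := by
      intro s
      rw [← card_product]
      refine card_le_card_of_injOn (fun p => (s • p.1, t • p.1 + p.2)) ?_ ?_
      · intro p hp
        simp only [hE, coe_filter, mem_univ, true_and, Set.mem_ofPred_eq] at hp
        simp [hp]
      · intro p hp p' hp' h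
        simp only [hE, coe_filter, mem_univ, true_and, Set.mem_ofPred_eq] at hp
        simp only [Prod.mk.injEq] at h
        have h1 : p.1 = p'.1 := smul_right_injective V hp.2.1 h.1
        have h2 := h.2
        rw [h1] at h2
        exact Prod.ext h1 (add_left_cancel h2)
    have hsub : G \ (univ.biUnion E) ⊆ ({p : V × V | t ∈ A p} : Finset _) := by
      intro p hp
      simp only [hG, hE, mem_sdiff, mem_filter, mem_univ, true_and, mem_biUnion, not_exists] at hp
      simp only [A, mem_filter, mem_univ, true_and]
      refine ⟨hp.1, fun s hs hh => hp.2 s ⟨hp.1, hs, ?_⟩⟩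
      have := hSB _ hh.1 _ hh.2 _ hp.1 (by module)
      rwa [show (t + s) • p.1 + p.2 - (t • p.1 + p.2) = s • p.1 by module] at this
    have hU : #(univ.biUnion E) ≤ Fintype.card F * (#B * #S) := by
      refine card_biUnion_le.trans ?_
      rw [← card_univ, ← smul_eq_mul]
      exact sum_le_card_nsmul _ _ _ fun s _ => hEcard s
    have h1 := (le_card_sdiff (univ.biUnion E) G).trans (card_le_card hsub)
    have h2 : 2 * (Fintype.card F * (#B * #S)) ≤ Fintype.card V * #S := by
      calc _ = 2 * (Fintype.card F * #B) * #S := by ring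
        _ ≤ _ := Nat.mul_le_mul_right _ hB
    omega
  have hsum : ∑ p : V × V, #(A p) = ∑ t : F, #{p : V × V | t ∈ A p} := by
    have := sum_card_bipartiteAbove_eq_sum_card_bipartiteBelow (s := (univ : Finset (V × V)))
      (t := (univ : Finset F)) (fun p t => t ∈ A p)
    simpa [bipartiteAbove, bipartiteBelow] using this
  obtain ⟨p, -, hp⟩ := exists_max_image (univ : Finset (V × V)) (fun p => #(A p)) ⟨0, mem_univ _⟩
  refine ⟨A p, hfree p, ?_⟩
  have h1 : Fintype.card F * (Fintype.card V * #S) ≤ 2 * ∑ t : F, #{p : V × V | t ∈ A p} := by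
    rw [mul_sum, ← card_univ, ← smul_eq_mul]
    exact card_nsmul_le_sum _ _ _ fun t _ => hpt t
  have h2 : ∑ p : V × V, #(A p) ≤ Fintype.card V * Fintype.card V * #(A p) := by
    rw [← Fintype.card_prod, ← card_univ, ← smul_eq_mul]
    exact sum_le_card_nsmul _ _ _ fun q hq => hp q hq
  have hV : 0 < Fintype.card V := Fintype.card_pos
  refine Nat.le_of_mul_le_mul_left ?_ hV
  rw [← hsum] at h1
  nlinarith

/-- Elkin's improvement of Behrend's construction, in `ZMod P`. -/
theorem exists_large_threeAPFree_zmod {P : ℕ} (hP : P.Prime) (hodd : P ≠ 2) {d : ℕ} (hd : 0 < d)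
    {ρ : ℝ} (hρ : 1 ≤ ρ) (hball : 2 * P * (9 * ρ) ^ d ≤ (P : ℝ) ^ d) :
    ∃ A : Finset (ZMod P), ThreeAPFree (A : Set (ZMod P)) ∧
      (P : ℝ) * min 1 (√d * ρ ^ 2 / P ^ 2) ≤ 16 * 2 ^ d * #A := by
  have : Fact P.Prime := ⟨hP⟩
  have hPpos : (0 : ℝ) < P := by exact_mod_cast hP.pos
  have hdpos : (0 : ℝ) < d := by exact_mod_cast hd
  have hPodd : P % 2 = 1 := hP.eq_two_or_odd.resolve_left hodd
  -- Coordinates below h have sums below P, so progressions modulo P are progressions of integers.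
  -- The restriction costs the factor 2^d.
  set h := (P + 1) / 2 with hh
  have hh2 : 2 * h = P + 1 := by omega
  have hhP : h ≤ P := by have := hP.two_le; omega
  have : Nonempty (Fin h) := ⟨⟨0, by omega⟩⟩
  have hR : 0 < (d : ℝ) * ρ ^ 2 := by positivity
  obtain ⟨j, hj⟩ := exists_large_shell (ι := Fin h) (f := fun v => ((v : ℕ) : ℝ) ^ 2)
    (K := (P : ℝ) ^ 2) (R := d * ρ ^ 2) (by positivity) hR (fun v => ⟨by positivity, by
      have : ((v : ℕ) : ℝ) ≤ P := by exact_mod_cast (v.2.le.trans hhP)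
      exact pow_le_pow_left₀ (by positivity) this 2⟩) hd
  set Q := ({x : Fin d → Fin h | ⌊(∑ i, ((x i : ℕ) : ℝ) ^ 2) / (d * ρ ^ 2)⌋ = j} : Finset _) with hQ
  let e : (Fin d → Fin h) → (Fin d → ZMod P) := fun x i => ((x i : ℕ) : ZMod P)
  have he : Function.Injective e := by
    intro x y hxy
    funext i
    have := congrFun hxy i
    simp only [e] at this
    rw [ZMod.natCast_eq_natCast_iff'] at this
    rw [Nat.mod_eq_of_lt ((x i).2.trans_le hhP), Nat.mod_eq_of_lt ((y i).2.trans_le hhP)] at this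
    exact Fin.ext this
  set I := intBall d P (d * ρ ^ 2) with hI
  let ci : (Fin d → ℤ) → (Fin d → ZMod P) := fun x i => (x i : ZMod P)
  have hSB : ∀ x ∈ Q.image e, ∀ y ∈ Q.image e, ∀ z ∈ Q.image e, x + y = z + z →
      y - z ∈ I.image ci := by
    simp only [mem_image]
    rintro _ ⟨x, hx, rfl⟩ _ ⟨y, hy, rfl⟩ _ ⟨z, hz, rfl⟩ hxyz
    have hnat : ∀ i, (x i : ℕ) + y i = z i + z i := by
      intro i
      have := congrFun hxyz i
      simp only [e, Pi.add_apply, ← Nat.cast_add] at this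
      rw [ZMod.natCast_eq_natCast_iff'] at this
      have h1 := (x i).2
      have h2 := (y i).2
      have h3 := (z i).2
      rwa [Nat.mod_eq_of_lt (by omega), Nat.mod_eq_of_lt (by omega)] at this
    refine ⟨fun i => (y i : ℤ) - z i, ?_, ?_⟩
    · rw [hI, intBall, mem_filter, Fintype.mem_piFinset]
      constructor
      · intro i
        have h2 := (y i).2
        have h3 := (z i).2
        rw [mem_Icc]; omega
      · simp only [hQ, mem_filter, mem_univ, true_and] at hx hy hz
        rw [Int.floor_eq_iff, le_div_iff₀ hR, div_lt_iff₀ hR] at hx hy hz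
        -- Parallelogram law: with all three squared norms in one window of width R = dρ², the right
        -- side is below 2R, so the common difference lies in the ball.
        have hid : ∑ i, ((((y i : ℤ) - (z i : ℤ) : ℤ) : ℝ)) ^ 2 * 2 =
            ∑ i, ((x i : ℕ) : ℝ) ^ 2 + ∑ i, ((y i : ℕ) : ℝ) ^ 2 - 2 * ∑ i, ((z i : ℕ) : ℝ) ^ 2 := by
          rw [mul_sum, ← sum_add_distrib, ← sum_sub_distrib]
          refine sum_congr rfl fun i _ => ?_
          have h1 : ((x i : ℕ) : ℝ) + (y i : ℕ) = (z i : ℕ) + (z i : ℕ) := by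
            exact_mod_cast hnat i
          push_cast
          rw [show ((x i : ℕ) : ℝ) = 2 * (z i : ℕ) - (y i : ℕ) by linarith]
          ring
        rw [← sum_mul] at hid
        nlinarith
    · funext i
      simp [ci, e]
  have hIcard := card_intBall_le d P hρ
  rw [← hI] at hIcard
  obtain ⟨A, hA, hcard⟩ := exists_threeAPFree_of_difference_subset (F := ZMod P)
    (Q.image e) (I.image ci) hSB (by
      rw [ZMod.card, Fintype.card_fun, ZMod.card, Fintype.card_fin]
      have h1 : (#(I.image ci) : ℝ) ≤ #I := by exact_mod_cast card_image_le
      have h2 : 2 * ((P : ℝ) * #(I.image ci)) ≤ (P : ℝ) ^ d := by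
        refine le_trans ?_ hball
        rw [mul_assoc]
        have := h1.trans hIcard
        gcongr
      exact_mod_cast h2)
  refine ⟨A, hA, ?_⟩
  rw [ZMod.card, Fintype.card_fun, ZMod.card, Fintype.card_fin, card_image_of_injective _ he] at hcard
  have hcard' : (P : ℝ) * #Q ≤ 2 * (P : ℝ) ^ d * #A := by exact_mod_cast hcard
  rw [Fintype.card_fin] at hj
  have ht : (d : ℝ) * ρ ^ 2 / (√d * P ^ 2) = √d * ρ ^ 2 / P ^ 2 := by
    nth_rewrite 1 [← Real.mul_self_sqrt hdpos.le]
    field_simp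
  rw [ht] at hj
  set t := min 1 (√d * ρ ^ 2 / (P : ℝ) ^ 2)
  have ht0 : 0 ≤ t := le_min zero_le_one (by positivity)
  have hPh : (P : ℝ) ^ d ≤ 2 ^ d * (h : ℝ) ^ d := by
    rw [← mul_pow]
    refine pow_le_pow_left₀ hPpos.le ?_ d
    have : ((2 * h : ℕ) : ℝ) = ((P + 1 : ℕ) : ℝ) := by rw [hh2]
    push_cast at this
    linarith
  have hPd : (0 : ℝ) < (P : ℝ) ^ d := by positivity
  refine le_of_mul_le_mul_left ?_ hPd
  calc (P : ℝ) ^ d * (P * t) ≤ 2 ^ d * (h : ℝ) ^ d * (P * t) := by gcongr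
    _ = 2 ^ d * P * ((h : ℝ) ^ d * t) := by ring
    _ ≤ 2 ^ d * P * (8 * #Q) := by gcongr
    _ = 8 * 2 ^ d * (P * #Q) := by ring
    _ ≤ 8 * 2 ^ d * (2 * (P : ℝ) ^ d * #A) := by gcongr
    _ = _ := by ring

/-! ### Hashing disjoint pairs and removing conflicts. -/

/-- Equal cardinality gives a coordinate in X outside Y. Translating it by t shifts exactly one of
the two sums by t, so translates of the solution set are disjoint. -/
theorem card_filter_sum_eq_sum_mul_le {F : Type*} [Field F] [Fintype F] [DecidableEq F] {n : ℕ}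
    {X Y : Finset (Fin n)} (hcard : #X = #Y) (hne : X ≠ Y) :
    #{w : Fin n → F | ∑ i ∈ X, w i = ∑ i ∈ Y, w i} * Fintype.card F ≤ Fintype.card F ^ n := by
  obtain ⟨i, hiX, hiY⟩ : ∃ i ∈ X, i ∉ Y := by
    by_contra! h
    exact hne (eq_of_subset_of_card_le h hcard.ge)
  have hpi : Fintype.card F ^ n = #(univ : Finset (Fin n → F)) := by simp
  rw [hpi, ← card_univ (α := F), ← card_product]
  refine card_le_card_of_injOn (fun q => Function.update q.1 i (q.1 i + q.2))
    (fun _ _ => mem_coe.2 (mem_univ _)) ?_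
  have hX : ∀ (w : Fin n → F) t, ∑ j ∈ X, Function.update w i (w i + t) j = ∑ j ∈ X, w j + t := by
    intro w t
    rw [sum_update_of_mem hiX, ← add_sum_erase X w hiX, sdiff_singleton_eq_erase]
    ring
  have hY : ∀ (w : Fin n → F) t, ∑ j ∈ Y, Function.update w i (w i + t) j = ∑ j ∈ Y, w j :=
    fun w t => sum_update_of_notMem hiY _ _
  rintro ⟨w, t⟩ hw ⟨w', t'⟩ hw' h
  simp only [coe_product, Set.mem_prod, coe_filter, mem_univ, true_and, Set.mem_ofPred_eq] at hw hw'
  have h' : Function.update w i (w i + t) = Function.update w' i (w' i + t') := h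
  have h1 := hX w t
  have h2 := hY w t
  rw [h', hX] at h1
  rw [h', hY] at h2
  have ht : t = t' := by
    have a1 := hw.1
    have a2 := hw'.1
    rw [a2, h2, ← a1] at h1
    exact (add_left_cancel h1).symm
  subst ht
  refine Prod.ext (funext fun j => ?_) rfl
  have := congrFun h' j
  by_cases hj : j = i
  · subst hj; simpa using this
  · simpa [hj] using this

/-- Ordered pairs of disjoint `k`-subsets of `Fin n`. -/
def disjointPairs (n k : ℕ) : Finset (Finset (Fin n) × Finset (Fin n)) :=
  {e ∈ powersetCard k univ ×ˢ powersetCard k univ | Disjoint e.1 e.2}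

theorem mem_disjointPairs {n k : ℕ} {e : Finset (Fin n) × Finset (Fin n)} :
    e ∈ disjointPairs n k ↔ #e.1 = k ∧ #e.2 = k ∧ Disjoint e.1 e.2 := by
  simp [disjointPairs, mem_powersetCard, and_assoc]

theorem card_disjointPairs (n k : ℕ) :
    #(disjointPairs n k) = n.choose k * (n - k).choose k := by
  have hmaps : ∀ e ∈ disjointPairs n k, e.1 ∈ powersetCard k (univ : Finset (Fin n)) := by
    intro e he
    simpa [mem_powersetCard] using (mem_disjointPairs.1 he).1
  rw [card_eq_sum_card_fiberwise hmaps, sum_const_nat (m := (n - k).choose k)]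
  · simp
  · intro A hA
    have hAk : #A = k := (mem_powersetCard.1 hA).2
    have : #(powersetCard k Aᶜ) = (n - k).choose k := by
      rw [card_powersetCard, card_compl, hAk, Fintype.card_fin]
    rw [← this]
    refine card_bij' (fun e _ => e.2) (fun B _ => (A, B)) ?_ ?_ ?_ ?_
    · rintro ⟨A', B⟩ he
      simp only [mem_filter, mem_disjointPairs] at he
      obtain ⟨⟨-, h2, h3⟩, rfl⟩ := he
      rw [mem_powersetCard, subset_compl_comm, subset_compl_iff_disjoint_right]
      exact ⟨h3, h2⟩
    · intro B hB
      rw [mem_powersetCard, subset_compl_comm, subset_compl_iff_disjoint_right] at hB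
      simp only [mem_filter, mem_disjointPairs]
      exact ⟨⟨hAk, hB.2, hB.1⟩, trivial⟩
    · rintro ⟨A', B⟩ he
      exact Prod.ext (mem_filter.1 he).2.symm rfl
    · intro B hB
      rfl

/-- Two pairs conflict if they are distinct and share a member or have the same union. -/
def Conflict {n : ℕ} (e e' : Finset (Fin n) × Finset (Fin n)) : Prop :=
  e' ≠ e ∧ (e'.1 = e.1 ∨ e'.2 = e.2 ∨ e'.1 ∪ e'.2 = e.1 ∪ e.2)

open Classical in
theorem card_conflict_le {n k : ℕ} (hk : 3 * k ≤ n) {e : Finset (Fin n) × Finset (Fin n)}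
    (he : e ∈ disjointPairs n k) :
    #{e' ∈ disjointPairs n k | Conflict e e'} ≤ 3 * (n - k).choose k := by
  obtain ⟨A, B⟩ := e
  obtain ⟨hA, hB, hAB⟩ := mem_disjointPairs.1 he
  simp only at hA hB hAB
  have hsub : {e' ∈ disjointPairs n k | Conflict (A, B) e'} ⊆
      (powersetCard k Aᶜ).image (fun B' => (A, B')) ∪
        ((powersetCard k Bᶜ).image (fun A' => (A', B)) ∪
          (powersetCard k (A ∪ B)).image (fun A' => (A', (A ∪ B) \ A'))) := by
    rintro ⟨A', B'⟩ he'
    obtain ⟨h1, -, h2⟩ := mem_filter.1 he'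
    obtain ⟨hA', hB', hAB'⟩ := mem_disjointPairs.1 h1
    simp only at hA' hB' hAB' h2
    simp only [mem_union, mem_image, mem_powersetCard, Prod.mk.injEq]
    rcases h2 with rfl | rfl | h2
    · refine Or.inl ⟨B', ⟨?_, hB'⟩, rfl, rfl⟩
      rw [subset_compl_comm, subset_compl_iff_disjoint_right]; exact hAB'
    · refine Or.inr (Or.inl ⟨A', ⟨?_, hA'⟩, rfl, rfl⟩)
      rw [subset_compl_iff_disjoint_right]; exact hAB'
    · refine Or.inr (Or.inr ⟨A', ⟨?_, hA'⟩, rfl, ?_⟩)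
      · rw [← h2]; exact subset_union_left
      · rw [← h2]; exact union_sdiff_cancel_left hAB'
  refine (card_le_card hsub).trans ((card_union_le _ _).trans ?_)
  have c1 : #((powersetCard k Aᶜ).image (fun B' => (A, B'))) ≤ (n - k).choose k := by
    refine card_image_le.trans ?_
    rw [card_powersetCard, card_compl, hA, Fintype.card_fin]
  have c2 : #((powersetCard k Bᶜ).image (fun A' => (A', B))) ≤ (n - k).choose k := by
    refine card_image_le.trans ?_
    rw [card_powersetCard, card_compl, hB, Fintype.card_fin]
  have c3 : #((powersetCard k (A ∪ B)).image (fun A' => (A', (A ∪ B) \ A'))) ≤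
      (n - k).choose k := by
    refine card_image_le.trans ?_
    rw [card_powersetCard, card_union_of_disjoint hAB, hA, hB]
    -- The hypothesis 3k ≤ n enters as 2k ≤ n - k.
    exact Nat.choose_le_choose _ (by omega)
  have := card_union_le ((powersetCard k Bᶜ).image (fun A' => (A', B)))
    ((powersetCard k (A ∪ B)).image (fun A' => (A', (A ∪ B) \ A')))
  omega

section Hash

variable {F : Type*} [Field F] {n k : ℕ}

/-- A pair `(A, B)` is kept by the hash `(w, u, v)` if `u + ∑ A, w` and `v + ∑ B, w` agree and lie
in `S`. -/
def Kept (S : Finset F) (p : (Fin n → F) × F × F) (e : Finset (Fin n) × Finset (Fin n)) : Prop :=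
  p.2.1 + ∑ i ∈ e.1, p.1 i = p.2.2 + ∑ i ∈ e.2, p.1 i ∧ p.2.1 + ∑ i ∈ e.1, p.1 i ∈ S

/-- Joint survival of conflicting pairs imposes a nontrivial linear condition on w alone,
independent of u, v. For equal unions, both w(A) + w(B) and w(A) - w(B) agree for the two pairs, and
2 is cancelled. -/
theorem exists_sum_eq_sum_of_conflict (h2 : (2 : F) ≠ 0) {e e' : Finset (Fin n) × Finset (Fin n)}
    (he : e ∈ disjointPairs n k) (he' : e' ∈ disjointPairs n k) (hc : Conflict e e') (S : Finset F) :
    ∃ X Y : Finset (Fin n), #X = #Y ∧ X ≠ Y ∧ ∀ p : (Fin n → F) × F × F, Kept S p e → Kept S p e' →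
      ∑ i ∈ X, p.1 i = ∑ i ∈ Y, p.1 i := by
  obtain ⟨A, B⟩ := e
  obtain ⟨A', B'⟩ := e'
  obtain ⟨hA, hB, hAB⟩ := mem_disjointPairs.1 he
  obtain ⟨hA', hB', hAB'⟩ := mem_disjointPairs.1 he'
  obtain ⟨hne, hc⟩ := hc
  simp only [ne_eq, Prod.mk.injEq, not_and] at *
  rcases hc with rfl | rfl | hc
  · refine ⟨B, B', hB.trans hB'.symm, fun h => hne rfl h.symm, fun p h h' => ?_⟩
    exact add_left_cancel (h.1.symm.trans h'.1)
  · refine ⟨A, A', hA.trans hA'.symm, fun h => hne h.symm rfl, fun p h h' => ?_⟩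
    exact add_left_cancel (h.1.trans h'.1.symm)
  · refine ⟨A, A', hA.trans hA'.symm, fun h => hne h.symm ?_, fun p h h' => ?_⟩
    · subst h
      rw [← union_sdiff_cancel_left hAB', hc, union_sdiff_cancel_left hAB]
    · have hs : ∑ i ∈ A', p.1 i + ∑ i ∈ B', p.1 i = ∑ i ∈ A, p.1 i + ∑ i ∈ B, p.1 i := by
        rw [← sum_union hAB, ← sum_union hAB', hc]
      have a1 := h.1
      have a2 := h'.1
      simp only at a1 a2
      refine mul_left_cancel₀ h2 ?_
      linear_combination a1 - a2 - hs

variable [Fintype F] [DecidableEq F]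

open Classical in
theorem card_filter_kept (S : Finset F) (W : Finset (Fin n → F))
    (e : Finset (Fin n) × Finset (Fin n)) :
    #{p : (Fin n → F) × F × F | p.1 ∈ W ∧ Kept S p e} = #W * #S := by
  rw [← card_product]
  refine card_bij' (fun p _ => (p.1, p.2.1 + ∑ i ∈ e.1, p.1 i))
    (fun q _ => (q.1, q.2 - ∑ i ∈ e.1, q.1 i, q.2 - ∑ i ∈ e.2, q.1 i)) ?_ ?_ ?_ ?_
  · intro p hp
    obtain ⟨h1, h2, h3⟩ := (mem_filter.1 hp).2
    exact mem_product.2 ⟨h1, h3⟩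
  · intro q hq
    obtain ⟨h1, h2⟩ := mem_product.1 hq
    exact mem_filter.2 ⟨mem_univ _, h1, by simp, by simpa using h2⟩
  · rintro ⟨w, u, v⟩ hp
    obtain ⟨h1, h2, h3⟩ := (mem_filter.1 hp).2
    simp only at h2
    simp [h2, sub_eq_iff_eq_add]
  · intro q hq
    simp

/-- The kept disjoint pairs that conflict with no other kept disjoint pair. -/
noncomputable def isolatedPairs (S : Finset F) (k : ℕ) (p : (Fin n → F) × F × F) :
    Finset (Finset (Fin n) × Finset (Fin n)) :=
  open Classical in
  {e ∈ disjointPairs n k | Kept S p e ∧ ∀ e' ∈ disjointPairs n k, Kept S p e' → ¬ Conflict e e'}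

/-- Union bound: `e` is kept by q^n |S| hashes, and each of its at most 3·C(n-k,k) conflicts spoils
at most a fraction 1/q of them. -/
theorem card_mul_card_le_card_isolated (h2 : (2 : F) ≠ 0) (hk : 3 * k ≤ n) (S : Finset F)
    {e : Finset (Fin n) × Finset (Fin n)} (he : e ∈ disjointPairs n k) :
    Fintype.card F ^ (n + 1) * #S ≤
      Fintype.card F * #{p : (Fin n → F) × F × F | e ∈ isolatedPairs S k p} +
        3 * (n - k).choose k * (Fintype.card F ^ n * #S) := by
  classical
  set q := Fintype.card F with hq
  set N := {e' ∈ disjointPairs n k | Conflict e e'} with hN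
  set G : Finset ((Fin n → F) × F × F) := {p | p.1 ∈ univ ∧ Kept S p e} with hG
  set E : Finset (Fin n) × Finset (Fin n) → Finset ((Fin n → F) × F × F) := fun e' =>
    {p | Kept S p e ∧ Kept S p e'} with hE
  have hGc : #G = q ^ n * #S := by
    rw [hG, card_filter_kept]; simp [hq]
  have hEc : ∀ e' ∈ N, q * #(E e') ≤ q ^ n * #S := by
    intro e' he'
    obtain ⟨h1, h3⟩ := mem_filter.1 he'
    obtain ⟨X, Y, hXY, hne, hsum⟩ := exists_sum_eq_sum_of_conflict h2 he h1 h3 S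
    have hsub : E e' ⊆ ({p : (Fin n → F) × F × F |
        p.1 ∈ ({w | ∑ i ∈ X, w i = ∑ i ∈ Y, w i} : Finset (Fin n → F)) ∧ Kept S p e} : Finset _) := by
      intro p hp
      obtain ⟨h4, h5⟩ := (mem_filter.1 hp).2
      simp [hsum p h4 h5, h4]
    have h6 := card_le_card hsub
    rw [card_filter_kept] at h6
    calc q * #(E e') ≤ q * (_ * #S) := Nat.mul_le_mul_left _ h6
      _ = _ * q * #S := by ring
      _ ≤ q ^ n * #S := Nat.mul_le_mul_right _ (card_filter_sum_eq_sum_mul_le hXY hne)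
  have hsub : G \ N.biUnion E ⊆ ({p : (Fin n → F) × F × F | e ∈ isolatedPairs S k p} : Finset _) := by
    intro p hp
    simp only [hG, hE, hN, mem_sdiff, mem_filter, mem_univ, true_and, mem_biUnion, not_exists,
      not_and] at hp
    simp only [isolatedPairs, mem_filter, mem_univ, true_and]
    exact ⟨he, hp.1, fun e' h1 h3 h4 => hp.2 e' ⟨h1, h4⟩ hp.1 h3⟩
  have hU : q * #(N.biUnion E) ≤ 3 * (n - k).choose k * (q ^ n * #S) := by
    calc q * #(N.biUnion E) ≤ q * ∑ e' ∈ N, #(E e') := Nat.mul_le_mul_left _ card_biUnion_le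
      _ = ∑ e' ∈ N, q * #(E e') := mul_sum _ _ _
      _ ≤ #N * (q ^ n * #S) := by
          rw [← smul_eq_mul]; exact sum_le_card_nsmul _ _ _ hEc
      _ ≤ _ := Nat.mul_le_mul_right _ (card_conflict_le hk he)
  have h3 : #G ≤ #({p : (Fin n → F) × F × F | e ∈ isolatedPairs S k p} : Finset _) +
      #(N.biUnion E) := by
    have := (le_card_sdiff (N.biUnion E) G).trans (card_le_card hsub)
    omega
  calc q ^ (n + 1) * #S = q * #G := by rw [hGc]; ring
    _ ≤ q * (_ + _) := Nat.mul_le_mul_left _ h3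
    _ ≤ _ := by rw [mul_add]; exact Nat.add_le_add_left hU _

theorem exists_large_isolatedPairs (h2 : (2 : F) ≠ 0) (hk : 3 * k ≤ n) (S : Finset F) :
    ∃ p : (Fin n → F) × F × F, n.choose k * (n - k).choose k * #S * Fintype.card F ≤
      Fintype.card F ^ 3 * #(isolatedPairs S k p) +
        n.choose k * (n - k).choose k * #S * (3 * (n - k).choose k) := by
  classical
  set q := Fintype.card F with hq
  set T := n.choose k * (n - k).choose k with hT
  obtain ⟨p, -, hp⟩ := exists_max_image (univ : Finset ((Fin n → F) × F × F))
    (fun p => #(isolatedPairs S k p)) ⟨0, mem_univ _⟩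
  refine ⟨p, ?_⟩
  have hswap : ∑ e ∈ disjointPairs n k, #{p : (Fin n → F) × F × F | e ∈ isolatedPairs S k p} =
      ∑ p : (Fin n → F) × F × F, #(isolatedPairs S k p) := by
    have := sum_card_bipartiteAbove_eq_sum_card_bipartiteBelow
      (s := (univ : Finset ((Fin n → F) × F × F)))
      (t := disjointPairs n k) (fun p e => e ∈ isolatedPairs S k p)
    simp only [bipartiteAbove, bipartiteBelow] at this
    rw [← this]
    refine sum_congr rfl fun p _ => congrArg _ ?_
    ext e
    simp only [mem_filter, isolatedPairs]
    tauto
  have h1 : T * (q ^ (n + 1) * #S) ≤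
      q * ∑ p : (Fin n → F) × F × F, #(isolatedPairs S k p) +
        T * (3 * (n - k).choose k * (q ^ n * #S)) := by
    rw [← hswap, hT, ← card_disjointPairs, mul_sum, ← smul_eq_mul, ← smul_eq_mul (#_) (3 * _ * _),
      ← sum_const, ← sum_const, ← sum_add_distrib]
    exact sum_le_sum fun e he => card_mul_card_le_card_isolated h2 hk S he
  have h3 : ∑ p : (Fin n → F) × F × F, #(isolatedPairs S k p) ≤
      q ^ (n + 2) * #(isolatedPairs S k p) := by
    have : q ^ (n + 2) = #(univ : Finset ((Fin n → F) × F × F)) := by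
      simp [hq]; ring
    rw [this, ← smul_eq_mul]
    exact sum_le_card_nsmul _ _ _ fun p' hp' => hp p' hp'
  have hqpos : 0 < q ^ n := pow_pos Fintype.card_pos _
  refine Nat.le_of_mul_le_mul_left ?_ hqpos
  calc q ^ n * (T * #S * q) = T * (q ^ (n + 1) * #S) := by ring
    _ ≤ q * (q ^ (n + 2) * #(isolatedPairs S k p)) + T * (3 * (n - k).choose k * (q ^ n * #S)) :=
        h1.trans (Nat.add_le_add_right (Nat.mul_le_mul_left _ h3) _)
    _ = _ := by ring

end Hash

/-! ### From isolated pairs to tri-colored sum-free sets. -/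

/-- The indicator vector of a set over `ZMod 2`. -/
def indicatorVec {n : ℕ} (A : Finset (Fin n)) : Fin n → ZMod 2 := fun i => if i ∈ A then 1 else 0

theorem hammingNorm_indicatorVec {n : ℕ} (A : Finset (Fin n)) :
    hammingNorm (indicatorVec A) = #A := by
  simp [hammingNorm, indicatorVec]

theorem indicatorVec_injective {n : ℕ} : Function.Injective (indicatorVec (n := n)) := by
  intro A B h
  ext i
  have := congrFun h i
  by_cases hA : i ∈ A <;> by_cases hB : i ∈ B <;> simp_all [indicatorVec]

theorem indicatorVec_add {n : ℕ} (A B : Finset (Fin n)) :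
    indicatorVec A + indicatorVec B = indicatorVec (symmDiff A B) := by
  funext i
  by_cases hA : i ∈ A <;> by_cases hB : i ∈ B <;>
    simp [indicatorVec, hA, hB, mem_symmDiff, CharTwo.add_self_eq_zero]

theorem disjoint_of_card_symmDiff {α : Type*} [DecidableEq α] {A B : Finset α}
    (h : #(symmDiff A B) = #A + #B) : Disjoint A B := by
  have h1 : symmDiff A B ⊆ A ∪ B := symmDiff_le_sup
  have h2 := card_le_card h1
  have h3 := card_union_add_card_inter A B
  rw [disjoint_iff_inter_eq_empty, ← card_eq_zero]
  omega

theorem exists_triColoredSumFree_of_threeAPFree {F : Type*} [Field F] [Fintype F] [DecidableEq F]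
    (h2 : (2 : F) ≠ 0) {n k : ℕ} (hk : 3 * k ≤ n) {S : Finset F} (hS : ThreeAPFree (S : Set F)) :
    ∃ (m : ℕ) (a b c : Fin m → (Fin n → ZMod 2)), IsTriColoredSumFree a b c ∧
      (∀ i, hammingNorm (a i) = k ∧ hammingNorm (b i) = k ∧
        hammingNorm (c i) = 2 * k ∧ c i = a i + b i) ∧
      n.choose k * (n - k).choose k * #S * Fintype.card F ≤
        Fintype.card F ^ 3 * m + n.choose k * (n - k).choose k * #S * (3 * (n - k).choose k) := by
  classical
  obtain ⟨p, hp⟩ := exists_large_isolatedPairs h2 hk S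
  set I := isolatedPairs S k p with hI
  let f : Fin #I → Finset (Fin n) × Finset (Fin n) := fun i => (I.equivFin.symm i : _)
  have hfinj : Function.Injective f := Subtype.val_injective.comp I.equivFin.symm.injective
  have hf : ∀ i, f i ∈ disjointPairs n k ∧ Kept S p (f i) ∧
      ∀ e' ∈ disjointPairs n k, Kept S p e' → ¬ Conflict (f i) e' := by
    intro i
    have : f i ∈ I := (I.equivFin.symm i).2
    simpa only [hI, isolatedPairs, mem_filter] using this
  have hunion : ∀ i, symmDiff (f i).1 (f i).2 = (f i).1 ∪ (f i).2 := fun i =>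
    (mem_disjointPairs.1 (hf i).1).2.2.symmDiff_eq_sup
  refine ⟨#I, fun i => indicatorVec (f i).1, fun i => indicatorVec (f i).2,
    fun i => indicatorVec (f i).1 + indicatorVec (f i).2, ?_, ?_, hp⟩
  · intro i j l
    constructor
    · intro h
      have h' : indicatorVec (f i).1 + indicatorVec (f j).2 =
          indicatorVec (f l).1 + indicatorVec (f l).2 := by
        have := eq_neg_of_add_eq_zero_left h
        rw [this]
        funext x
        simp [CharTwo.neg_eq]
      rw [indicatorVec_add, indicatorVec_add, hunion] at h'
      have hset := indicatorVec_injective h'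
      obtain ⟨hi1, hi2, hi3⟩ := mem_disjointPairs.1 (hf i).1
      obtain ⟨hj1, hj2, hj3⟩ := mem_disjointPairs.1 (hf j).1
      obtain ⟨hl1, hl2, hl3⟩ := mem_disjointPairs.1 (hf l).1
      have hdis : Disjoint (f i).1 (f j).2 := by
        apply disjoint_of_card_symmDiff
        rw [hset, card_union_of_disjoint hl3, hl1, hl2, hi1, hj2]
      rw [hdis.symmDiff_eq_sup] at hset
      change (f i).1 ∪ (f j).2 = (f l).1 ∪ (f l).2 at hset
      have hsum : ∑ x ∈ (f i).1, p.1 x + ∑ x ∈ (f j).2, p.1 x =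
          ∑ x ∈ (f l).1, p.1 x + ∑ x ∈ (f l).2, p.1 x := by
        rw [← sum_union hdis, ← sum_union hl3, hset]
      have hKi := (hf i).2.1
      have hKj := (hf j).2.1
      have hKl := (hf l).2.1
      -- The hash values of A_i, the pair l, and B_j form a progression in S, hence are all equal;
      -- so the mixed pair (A_i, B_j) is kept.
      have hap : (p.2.1 + ∑ x ∈ (f i).1, p.1 x) + (p.2.2 + ∑ x ∈ (f j).2, p.1 x) =
          (p.2.1 + ∑ x ∈ (f l).1, p.1 x) + (p.2.1 + ∑ x ∈ (f l).1, p.1 x) := by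
        linear_combination hsum - hKl.1
      have heq := hS hKi.2 hKl.2 (hKj.1 ▸ hKj.2) hap
      have hE : ((f i).1, (f j).2) ∈ disjointPairs n k := mem_disjointPairs.2 ⟨hi1, hj2, hdis⟩
      have hK : Kept S p ((f i).1, (f j).2) := by
        refine ⟨?_, hKi.2⟩
        simp only
        linear_combination 2 * heq - hap
      have e1 : ((f i).1, (f j).2) = f i := by
        by_contra hne
        exact (hf i).2.2 _ hE hK ⟨hne, Or.inl rfl⟩
      have e2 : ((f i).1, (f j).2) = f j := by
        by_contra hne
        exact (hf j).2.2 _ hE hK ⟨hne, Or.inr (Or.inl rfl)⟩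
      have e3 : ((f i).1, (f j).2) = f l := by
        by_contra hne
        exact (hf l).2.2 _ hE hK ⟨hne, Or.inr (Or.inr hset)⟩
      exact ⟨hfinj (e1.symm.trans e2), hfinj (e2.symm.trans e3)⟩
    · rintro ⟨rfl, rfl⟩
      funext x
      simp only [Pi.add_apply, Pi.zero_apply]
      exact CharTwo.add_self_eq_zero _
  · intro i
    obtain ⟨h1, h3, h4⟩ := mem_disjointPairs.1 (hf i).1
    refine ⟨?_, ?_, ?_, rfl⟩
    · rw [hammingNorm_indicatorVec, h1]
    · rw [hammingNorm_indicatorVec, h3]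
    · change hammingNorm (indicatorVec (f i).1 + indicatorVec (f i).2) = 2 * k
      rw [indicatorVec_add, hammingNorm_indicatorVec, hunion, card_union_of_disjoint h4, h1, h3]
      ring

/-! ### Choice of parameters and asymptotics. -/

theorem two_mul_nine_pow_le {P : ℝ} (hP : 100 ≤ P) {d : ℕ} (hd : 4 ≤ d) :
    2 * P * 9 ^ d ≤ P ^ d := by
  obtain ⟨e, rfl⟩ : ∃ e, d = e + 1 := ⟨d - 1, by omega⟩
  have h1 : (4 : ℝ) ^ 3 ≤ 4 ^ e := pow_le_pow_right₀ (by norm_num) (by omega)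
  have h2 : ((9 : ℝ) * 4) ^ e ≤ P ^ e := pow_le_pow_left₀ (by norm_num) (by linarith) e
  rw [mul_pow] at h2
  have h3 : (0 : ℝ) < 9 ^ e := by positivity
  have h4 : 2 * (9 : ℝ) ^ (e + 1) ≤ P ^ e := by
    rw [pow_succ]; nlinarith
  calc 2 * P * 9 ^ (e + 1) = P * (2 * 9 ^ (e + 1)) := by ring
    _ ≤ P * P ^ e := by gcongr
    _ = P ^ (e + 1) := by ring

theorem exists_large_threeAPFree_zmod_rpow {P : ℕ} (hP : P.Prime) (h100 : 100 ≤ P) {d : ℕ}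
    (hd : 4 ≤ d) :
    ∃ A : Finset (ZMod P), ThreeAPFree (A : Set (ZMod P)) ∧
      (P : ℝ) * min 1 (√d / (81 * (2 * P : ℝ) ^ (2 / d : ℝ))) ≤ 16 * 2 ^ d * #A := by
  have hPpos : (0 : ℝ) < P := by exact_mod_cast hP.pos
  have h2P : (0 : ℝ) < 2 * P := by positivity
  set r := (2 * P : ℝ) ^ (1 / d : ℝ) with hr
  have hrpos : 0 < r := Real.rpow_pos_of_pos h2P _
  have hrd : r ^ d = 2 * P := by
    rw [hr, one_div]; exact Real.rpow_inv_natCast_pow h2P.le (by omega)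
  have hr2 : (2 * P : ℝ) ^ (2 / d : ℝ) = r ^ 2 := by
    rw [hr, ← Real.rpow_natCast, ← Real.rpow_mul h2P.le]; congr 1; push_cast; ring
  have h100' : (100 : ℝ) ≤ P := by exact_mod_cast h100
  -- With r^d = 2P, this is the largest ρ the ball condition allows: `hball` holds with equality.
  have hρ : 1 ≤ P / (9 * r) := by
    rw [one_le_div (by positivity)]
    refine le_of_pow_le_pow_left₀ (n := d) (by omega) hPpos.le ?_
    rw [mul_pow, hrd, mul_comm]
    exact two_mul_nine_pow_le h100' hd
  have hball : 2 * P * (9 * (P / (9 * r))) ^ d ≤ (P : ℝ) ^ d := by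
    rw [show 9 * (P / (9 * r)) = P / r by field_simp, div_pow, hrd]
    apply le_of_eq; field_simp
  obtain ⟨A, hA, h⟩ := exists_large_threeAPFree_zmod hP (by omega) (by omega) hρ hball
  refine ⟨A, hA, ?_⟩
  rw [hr2]
  convert h using 3
  field_simp
  norm_num

theorem two_mul_rpow_le {x : ℝ} {d P : ℕ} (hP : 0 < P) (hx : 0 ≤ x) (hd : 20 ≤ d)
    (hxd : x ≤ d) (hPx : (2 * P : ℝ) ≤ 2 ^ (x ^ 2 / 2 + 10)) :
    (2 * P : ℝ) ^ (2 / d : ℝ) ≤ 2 * 2 ^ x := by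
  have hdpos : (0 : ℝ) < d := by exact_mod_cast (by omega : 0 < d)
  have hd' : (20 : ℝ) ≤ d := by exact_mod_cast hd
  calc (2 * P : ℝ) ^ (2 / d : ℝ) ≤ (2 ^ (x ^ 2 / 2 + 10)) ^ (2 / d : ℝ) :=
        Real.rpow_le_rpow (by positivity) hPx (by positivity)
    _ = 2 ^ ((x ^ 2 + 20) / d) := by
        rw [← Real.rpow_mul (by norm_num)]; congr 1; field_simp; norm_num
    _ ≤ 2 ^ (1 + x) := by
        refine Real.rpow_le_rpow_of_exponent_le (by norm_num) ?_
        rw [div_le_iff₀ hdpos]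
        nlinarith
    _ = 2 * 2 ^ x := by rw [Real.rpow_add (by norm_num), Real.rpow_one]

/-- The shell loses 2^x, and √d must absorb every constant: 12800 · 81 · 2 < 2100000, whose square
is below 10^13. Here 12800 = 16 · 2 · 400 collects the losses of the final count. -/
theorem lt_min_one_of_large {x : ℝ} {d P : ℕ} (hP : 0 < P) (hx : 10 ^ 13 ≤ x)
    (hxd : x ≤ d) (hPx : (2 * P : ℝ) ≤ 2 ^ (x ^ 2 / 2 + 10)) :
    12800 < 2 ^ x * min 1 (√d / (81 * (2 * P : ℝ) ^ (2 / d : ℝ))) := by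
  have h2x : (0 : ℝ) < 2 ^ x := by positivity
  have hd : (20 : ℕ) ≤ d := by
    have : (20 : ℝ) ≤ d := by linarith
    exact_mod_cast this
  rcases min_choice (1 : ℝ) (√d / (81 * (2 * P : ℝ) ^ (2 / d : ℝ))) with h | h <;> rw [h]
  · calc (12800 : ℝ) < 2 ^ (14 : ℝ) := by norm_num
      _ ≤ 2 ^ x := Real.rpow_le_rpow_of_exponent_le (by norm_num) (by linarith)
      _ = _ := (mul_one _).symm
  · have h1 := two_mul_rpow_le hP (by linarith) hd hxd hPx
    have h2 : (2100000 : ℝ) < √d := by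
      rw [Real.lt_sqrt (by norm_num)]; linarith
    have h3 : (0 : ℝ) < (2 * P : ℝ) ^ (2 / d : ℝ) := by positivity
    rw [← mul_div_assoc, lt_div_iff₀ (by positivity)]
    nlinarith

theorem exists_triColoredSumFree_of_large {n : ℕ} (hn : 10 ^ 13 ≤ √(4 * (n : ℝ) / 3)) :
    ∃ (m : ℕ) (a b c : Fin m → (Fin n → ZMod 2)),
      IsTriColoredSumFree a b c ∧
      (∀ i, hammingNorm (a i) = n / 3 ∧ hammingNorm (b i) = n / 3 ∧
        hammingNorm (c i) = 2 * (n / 3) ∧ c i = a i + b i) ∧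
      (n.choose (n / 3) : ℝ) * (2 : ℝ) ^ (-√(16 * (n : ℝ) / 3)) < (m : ℝ) := by
  set x := √(4 * (n : ℝ) / 3) with hx
  set k := n / 3 with hk
  set D := (n - k).choose k with hD
  have hDpos : 0 < D := Nat.choose_pos (by omega)
  obtain ⟨P, hP, hDP, hPD⟩ := Nat.exists_prime_lt_and_le_two_mul (100 * D) (by omega)
  have : Fact P.Prime := ⟨hP⟩
  -- With P ≲ 2^(x²/2), the losses 2^d and (2P)^(2/d) balance at d ≈ x, each about 2^x; together
  -- they give 2^(2x) = 2^√(16n/3).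
  set d := ⌈x⌉₊ with hd
  have hxd : x ≤ d := Nat.le_ceil x
  have hdx : (d : ℝ) < x + 1 := Nat.ceil_lt_add_one (by linarith)
  have hx2 : x ^ 2 = 4 * n / 3 := Real.sq_sqrt (by positivity)
  have hd4 : 4 ≤ d := by
    have : (4 : ℝ) ≤ d := by linarith
    exact_mod_cast this
  have hPx : (2 * P : ℝ) ≤ 2 ^ (x ^ 2 / 2 + 10) := by
    have h1 : D ≤ 2 ^ (n - k) := Nat.choose_le_two_pow _ _
    have h2 : (2 * P : ℝ) ≤ 512 * 2 ^ (n - k) := by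
      have : 2 * P ≤ 512 * 2 ^ (n - k) := by omega
      exact_mod_cast this
    have h3 : ((n - k : ℕ) : ℝ) ≤ 2 * n / 3 + 1 := by
      have : 3 * (n - k) ≤ 2 * n + 3 := by omega
      have : (3 : ℝ) * ((n - k : ℕ) : ℝ) ≤ 2 * n + 3 := by exact_mod_cast this
      linarith
    calc (2 * P : ℝ) ≤ 2 ^ (9 : ℝ) * 2 ^ ((n - k : ℕ) : ℝ) := by
          rw [Real.rpow_natCast]; norm_num at h2 ⊢; exact h2
      _ = 2 ^ (9 + ((n - k : ℕ) : ℝ)) := (Real.rpow_add (by norm_num) _ _).symm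
      _ ≤ _ := Real.rpow_le_rpow_of_exponent_le (by norm_num) (by rw [hx2]; linarith)
  obtain ⟨A, hA, hAcard⟩ := exists_large_threeAPFree_zmod_rpow hP (by omega) hd4
  have ht := lt_min_one_of_large hP.pos hn hxd hPx
  set t := min 1 (√d / (81 * (2 * P : ℝ) ^ (2 / d : ℝ)))
  have h2 : (2 : ZMod P) ≠ 0 := by
    intro h
    have h' : ((2 : ℕ) : ZMod P) = 0 := by exact_mod_cast h
    have := Nat.le_of_dvd (by norm_num) ((ZMod.natCast_eq_zero_iff 2 P).1 h')
    omega
  obtain ⟨m, a, b, c, habc, hw, hm⟩ :=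
    exists_triColoredSumFree_of_threeAPFree h2 (show 3 * k ≤ n by omega) hA
  refine ⟨m, a, b, c, habc, hw, ?_⟩
  rw [ZMod.card, ← hD] at hm
  have hsqrt : √(16 * (n : ℝ) / 3) = 2 * x := by
    rw [Real.sqrt_eq_iff_mul_self_eq (by positivity) (by positivity)]
    nlinarith
  rw [hsqrt, Real.rpow_neg (by norm_num), ← div_eq_mul_inv, div_lt_iff₀ (by positivity)]
  have hbpos : (0 : ℝ) < n.choose k := by exact_mod_cast Nat.choose_pos (by omega)
  have hPpos : (0 : ℝ) < P := by exact_mod_cast hP.pos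
  have hD' : (0 : ℝ) < D := by exact_mod_cast hDpos
  have hm' : (n.choose k : ℝ) * D * #A * P ≤ P ^ 3 * m + n.choose k * D * #A * (3 * D) := by
    exact_mod_cast hm
  have hDP' : 100 * (D : ℝ) < P := by exact_mod_cast hDP
  have hPD' : (P : ℝ) ≤ 200 * D := by
    have : P ≤ 200 * D := by omega
    exact_mod_cast this
  have hbA : (n.choose k : ℝ) * #A ≤ 400 * (P * m) := by
    set y := (n.choose k : ℝ) * #A
    have hy : 0 ≤ y := by positivity
    -- As P > 100D, conflicts cost at most half: 3D ≤ P/2.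
    have h3 : y * D * (P / 2) ≤ P ^ 3 * m := by
      have : y * D * (P / 2) ≤ y * D * (P - 3 * D) := by
        gcongr; linarith
      calc _ ≤ _ := this
        _ ≤ _ := by simp only [y]; linarith
    have h4 : P ^ 2 * y ≤ P ^ 2 * (400 * (P * m)) := by
      calc (P : ℝ) ^ 2 * y = y * P * P := by ring
        _ ≤ y * (200 * D) * P := by gcongr
        _ = 400 * (y * D * (P / 2)) := by ring
        _ ≤ 400 * (P ^ 3 * m) := by gcongr
        _ = _ := by ring
    exact le_of_mul_le_mul_left h4 (by positivity)
  have h2d : (2 : ℝ) ^ d ≤ 2 * 2 ^ x := by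
    calc (2 : ℝ) ^ d = 2 ^ (d : ℝ) := (Real.rpow_natCast _ _).symm
      _ ≤ 2 ^ (1 + x) := Real.rpow_le_rpow_of_exponent_le (by norm_num) (by linarith)
      _ = 2 * 2 ^ x := by rw [Real.rpow_add (by norm_num), Real.rpow_one]
  have h2x : (2 : ℝ) ^ (2 * x) = 2 ^ x * 2 ^ x := by
    rw [two_mul, Real.rpow_add (by norm_num)]
  set z := (2 : ℝ) ^ x with hz
  have hzpos : 0 < z := by positivity
  have h5 : (n.choose k : ℝ) * t ≤ 12800 * z * m := by
    have : P * ((n.choose k : ℝ) * t) ≤ P * (12800 * z * m) := by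
      calc P * ((n.choose k : ℝ) * t) = n.choose k * (P * t) := by ring
        _ ≤ n.choose k * (16 * 2 ^ d * #A) := by gcongr
        _ = 16 * 2 ^ d * (n.choose k * #A) := by ring
        _ ≤ 16 * (2 * z) * (400 * (P * m)) := by gcongr
        _ = _ := by ring
    exact le_of_mul_le_mul_left this hPpos
  rw [h2x]
  have h6 : (12800 : ℝ) * n.choose k < 12800 * (m * (z * z)) := by
    calc (12800 : ℝ) * n.choose k < z * t * n.choose k := by gcongr
      _ = z * (n.choose k * t) := by ring
      _ ≤ z * (12800 * z * m) := by gcongr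
      _ = _ := by ring
  linarith

theorem isSubexponentialFactor_two_rpow_sqrt :
    IsSubexponentialFactor fun n : ℕ => 6 * (2 : ℝ) ^ √(16 * (n : ℝ) / 3) := by
  constructor
  · intro n
    have : (1 : ℝ) ≤ 2 ^ √(16 * (n : ℝ) / 3) :=
      Real.one_le_rpow (by norm_num) (Real.sqrt_nonneg _)
    linarith
  · have h : (fun n : ℕ => Real.log (6 * (2 : ℝ) ^ √(16 * (n : ℝ) / 3))) =
        fun n : ℕ => Real.log 6 + (√(16 / 3) * Real.log 2) * √(n : ℝ) := by
      funext n
      rw [Real.log_mul (by norm_num) (by positivity), Real.log_rpow (by norm_num),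
        show 16 * (n : ℝ) / 3 = 16 / 3 * n by ring, Real.sqrt_mul (by norm_num)]
      ring
    rw [h]
    refine Asymptotics.IsLittleO.add ?_ (Asymptotics.IsLittleO.const_mul_left ?_ _)
    · exact (Asymptotics.isLittleO_const_id_atTop (Real.log 6)).comp_tendsto
        tendsto_natCast_atTop_atTop
    · have h1 : (fun x : ℝ => √x) =o[Filter.atTop] fun x : ℝ => x := by
        refine Asymptotics.isLittleO_of_tendsto' ?_ ?_
        · filter_upwards [Filter.eventually_gt_atTop 0] with x hx h0
          exact absurd h0 hx.ne'
        · simp_rw [Real.sqrt_div_self]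
          exact Real.tendsto_sqrt_atTop.inv_tendsto_atTop
      exact h1.comp_tendsto tendsto_natCast_atTop_atTop

theorem mainTheorem3 :
    (∀ᶠ n : ℕ in Filter.atTop, ∃ (m : ℕ) (a b c : Fin m → (Fin n → ZMod 2)),
      IsTriColoredSumFree a b c ∧
      (∀ i, hammingNorm (a i) = n / 3 ∧ hammingNorm (b i) = n / 3 ∧
        hammingNorm (c i) = 2 * (n / 3) ∧ c i = a i + b i) ∧
      (n.choose (n / 3) : ℝ) * (2 : ℝ) ^ (-Real.sqrt (16 * (n : ℝ) / 3)) < (m : ℝ)) ∧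
    (∃ f : ℕ → ℝ, IsSubexponentialFactor f ∧
      ∀ᶠ n : ℕ in Filter.atTop, ∃ (m : ℕ) (a b c : Fin m → (Fin n → ZMod 2)),
        IsTriColoredSumFree a b c ∧
        6 * (n.choose (n / 3) : ℝ) ≤ f n * (m : ℝ)) := by
  have htend : Filter.Tendsto (fun n : ℕ => √(4 * (n : ℝ) / 3)) Filter.atTop Filter.atTop := by
    refine Real.tendsto_sqrt_atTop.comp ?_
    refine Filter.Tendsto.atTop_div_const (by norm_num) ?_
    exact Filter.Tendsto.const_mul_atTop (by norm_num) tendsto_natCast_atTop_atTop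
  have hlarge := htend.eventually_ge_atTop (10 ^ 13)
  refine ⟨hlarge.mono fun n hn => exists_triColoredSumFree_of_large hn, _,
    isSubexponentialFactor_two_rpow_sqrt, hlarge.mono fun n hn => ?_⟩
  obtain ⟨m, a, b, c, h, -, hm⟩ := exists_triColoredSumFree_of_large hn
  refine ⟨m, a, b, c, h, ?_⟩
  rw [Real.rpow_neg (by norm_num), ← div_eq_mul_inv, div_lt_iff₀ (by positivity)] at hm
  linarith
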